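/- For each $n\ge1$ let $\eta_1,\dots,\eta_{n+1}$ be independent Bernoulli variables with $P(\eta_i=1)=p=1-P(\eta_i=0)$, where $p=p_n$, and let $S_\xi=\sum_{i=1}^n\eta_i\eta_{i+1}$ be the 2-runs statistic. Put $$\bar p=\frac{np^3(2-3p)-2p^3(1-p)}{np^2+np^3(2-3p)-2p^3(1-p)},\qquad \bar q=1-\bar p,\qquad r=\frac{n^2p^4}{np^3(2-3p)-2p^3(1-p)},$$ and $$\mathrm{NB}(r,\bar q)\{j\}=\frac{\Gamma(r+j)}{j!\,\Gamma(r)}\,\bar q^{\,r}\,\bar p^{\,j}$$ (for these parameters the negative binomial distribution $\mathrm{NB}(r,\bar q)$ has the same mean and variance as $S_\xi$). Let $x=x_n$ be non-negative integers. If $p\to0$, $np\to\infty$ and $|x-np^2|=o\big(\min(np^2,\,n^{2/3}p^{2/3})\big)$ as $n\to\infty$, then $$\frac{P(S_\xi=x)}{\mathrm{NB}(r,\bar q)\{x\}}\to1\qquad(n\to\infty).$$ -/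

import Mathlib

open MeasureTheory ProbabilityTheory Filter Topology Asymptotics

/-- `η 0, …, η m` (any finite or infinite family) are independent, identically distributed Bernoulli
random variables with success probability `p`, on the measure space `(Ω, μ)`. -/
structure IsIIDBernoulli {ι Ω : Type*} [MeasurableSpace Ω] (μ : Measure Ω) (η : ι → Ω → ℕ)
    (p : ℝ) : Prop where
  measurable : ∀ i, Measurable (η i)
  indep : iIndepFun η μ
  prob_one : ∀ i, μ.real {ω | η i ω = 1} = p
  prob_zero : ∀ i, μ.real {ω | η i ω = 0} = 1 - p

/-- The 2-runs statistic `S = ∑ η_i η_{i+1}` (`n` summands) of the `n + 1` variables `η`. -/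
def twoRuns {Ω : Type*} {n : ℕ} (η : Fin (n + 1) → Ω → ℕ) (ω : Ω) : ℕ :=
  ∑ i : Fin n, η i.castSucc ω * η i.succ ω

/-- The probability `Γ(r + j) / (j! Γ(r)) * q ^ r * (1 - q) ^ j` that the negative binomial
distribution with (real) parameter `r` and parameter `q` gives to `j`. -/
noncomputable def negBinomial (r q : ℝ) (j : ℕ) : ℝ :=
  Real.Gamma (r + j) / (j.factorial * Real.Gamma r) * q ^ r * (1 - q) ^ j

/-- The difference between the variance and the mean of the 2-runs statistic. -/
noncomputable def runsExcess (n : ℕ) (p : ℝ) : ℝ :=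
  n * p ^ 3 * (2 - 3 * p) - 2 * p ^ 3 * (1 - p)

/-- The parameter `p̄` of the matching negative binomial distribution. -/
noncomputable def runsPbar (n : ℕ) (p : ℝ) : ℝ :=
  runsExcess n p / (n * p ^ 2 + runsExcess n p)

/-- The parameter `q̄ = 1 - p̄` of the matching negative binomial distribution. -/
noncomputable def runsQbar (n : ℕ) (p : ℝ) : ℝ := 1 - runsPbar n p

/-- The parameter `r` of the matching negative binomial distribution. -/
noncomputable def runsR (n : ℕ) (p : ℝ) : ℝ := (n : ℝ) ^ 2 * p ^ 4 / runsExcess n p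

/-! Write z = 1 + u, l = n p², E = `runsExcess n p`. The generating function of the runs obeys a
linear recurrence of order two, so it is a product of ratios of consecutive terms. These ratios are
near 1 and settle after two steps, whence its logarithm is l u + E u²/2 + O(n p⁴ |u|³). The negative
binomial one has logarithm -r log(1 - κu) with κ = E/l ≤ 2p, rκ = l and rκ² = E: the same two terms
and a remainder of the same order. The quotient of the two is therefore exp D with |D| ≤ 10 n p⁴
|u|³ (`exists_runsGenFun_eq_mul_exp`).

Cauchy's formula for the coefficient at x is applied to the difference on the circle |z| = ρ, where
ρ tilts the negative binomial law to mean x, so that |ρ - 1| ≤ |x - l|/l. On this circle its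
generating function is at most H0 exp(-xθ²/20) (`one_sub_cpow_norm_le`), and |D| is at most a
multiple of τ + p² xθ², with τ = |x - l|³ p²/l². Integration bounds the difference times ρ^x by O((τ
+ p²) H0/√x). By Stirling (`le_negBinomial_mean`) the negative binomial mass times ρ^x is at least
of order H0/√x, so the relative error is O(τ + p²). The hypothesis on x says exactly what makes τ →
0. -/

/-! ### Expansion of the logarithm of the runs generating function -/

/-- The logarithm of `1 + z` agrees with `z - z ^ 2 / 2` up to a cubic error. -/
theorem norm_log_one_add_sub_quadratic_le {z : ℂ} (hz : ‖z‖ ≤ 1 / 2) :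
    ‖Complex.log (1 + z) - (z - z ^ 2 / 2)‖ ≤ ‖z‖ ^ 3 := by
  have h := Complex.norm_log_sub_logTaylor_le 2 (z := z) (by linarith)
  have h2 : Complex.logTaylor 3 z = z - z ^ 2 / 2 := by
    simp [Complex.logTaylor_succ, Complex.logTaylor_zero]
    ring
  rw [h2] at h
  refine h.trans ?_
  have h3 : (1 - ‖z‖)⁻¹ ≤ 2 := by
    rw [inv_le_comm₀ (by linarith) (by norm_num)]
    linarith
  have h4 : 0 ≤ ‖z‖ ^ 3 := by positivity
  norm_num
  nlinarith

/-- The defect from `1` of the ratio of consecutive probability generating functions (at `1 + u`)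
of the 2-runs statistics. -/
noncomputable def runsDefect (p : ℝ) (u : ℂ) : ℕ → ℂ
  | 0 => 0
  | k + 1 => p ^ 2 * u + p * (1 - p) * u * (runsDefect p u k / (1 + runsDefect p u k))

theorem one_half_le_norm_one_add {e : ℂ} (he : ‖e‖ ≤ 1 / 2) : 1 / 2 ≤ ‖1 + e‖ := by
  have := norm_sub_le (1 + e) e
  simp at this
  linarith

theorem norm_div_one_add_le {e : ℂ} (he : ‖e‖ ≤ 1 / 2) : ‖e / (1 + e)‖ ≤ 2 * ‖e‖ := by
  have h := one_half_le_norm_one_add he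
  rw [norm_div, div_le_iff₀ (by linarith)]
  nlinarith [norm_nonneg e]

theorem norm_div_one_add_sub_le {e : ℂ} (he : ‖e‖ ≤ 1 / 2) :
    ‖e / (1 + e) - e‖ ≤ 2 * ‖e‖ ^ 2 := by
  have h := one_half_le_norm_one_add he
  have h0 : 1 + e ≠ 0 := norm_pos_iff.1 (by linarith)
  have : e / (1 + e) - e = -(e ^ 2 / (1 + e)) := by field_simp; ring
  rw [this, norm_neg, norm_div, norm_pow, div_le_iff₀ (by linarith)]
  nlinarith [sq_nonneg ‖e‖]

theorem norm_mul_one_sub_mul_le {p : ℝ} (hp : 0 < p) (hp1 : p ≤ 1 / 1000) (u : ℂ) :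
    ‖(p : ℂ) * (1 - p) * u‖ ≤ p * ‖u‖ := by
  have h1 : ‖(1 - p : ℂ)‖ ≤ 1 := by
    have : (1 - p : ℂ) = ((1 - p : ℝ) : ℂ) := by push_cast; rfl
    rw [this, Complex.norm_real, Real.norm_eq_abs, abs_le]
    constructor <;> linarith
  have h2 : ‖(p : ℂ)‖ = p := by rw [Complex.norm_real, Real.norm_of_nonneg hp.le]
  rw [norm_mul, norm_mul, h2]
  have : p * ‖(1 - p : ℂ)‖ ≤ p := by nlinarith
  exact mul_le_mul_of_nonneg_right this (norm_nonneg _)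

section
variable {p : ℝ} {u : ℂ}

/-- The recursion maps the disc of radius 2p²|u| into itself, because 4p|u| ≤ 1. The range |u| ≤ 4
covers the later circle, where |u| ≤ 1/2 + π. -/
theorem norm_runsDefect_le (hp : 0 < p) (hp1 : p ≤ 1 / 1000) (hu : ‖u‖ ≤ 4) (k : ℕ) :
    ‖runsDefect p u k‖ ≤ 2 * p ^ 2 * ‖u‖ := by
  induction k with
  | zero => simp only [runsDefect, norm_zero]; positivity
  | succ k ih =>
    have ht := norm_nonneg u
    have h0 : 2 * p ^ 2 * ‖u‖ ≤ 1 / 2 := by nlinarith [mul_nonneg hp.le ht, sq_nonneg p]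
    have h1 := norm_div_one_add_le (ih.trans h0)
    rw [runsDefect]
    refine (norm_add_le _ _).trans ?_
    rw [norm_mul (_ * _) (_ / _)]
    have h2 : ‖(p : ℂ) ^ 2 * u‖ = p ^ 2 * ‖u‖ := by
      rw [norm_mul, norm_pow, Complex.norm_real, Real.norm_of_nonneg hp.le]
    have h3 := norm_mul_one_sub_mul_le hp hp1 u
    have h4 : ‖(p : ℂ) * (1 - p) * u‖ * ‖runsDefect p u k / (1 + runsDefect p u k)‖ ≤
        (p * ‖u‖) * (4 * (p ^ 2 * ‖u‖)) :=
      mul_le_mul h3 (by linarith) (norm_nonneg _) (by positivity)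
    have h5 : 4 * (p * ‖u‖) ≤ 1 := by nlinarith
    have h6 : 0 ≤ p ^ 2 * ‖u‖ := by positivity
    rw [h2]
    nlinarith

theorem norm_runsDefect_le_half (hp : 0 < p) (hp1 : p ≤ 1 / 1000) (hu : ‖u‖ ≤ 4) (k : ℕ) :
    ‖runsDefect p u k‖ ≤ 1 / 2 := by
  refine (norm_runsDefect_le hp hp1 hu k).trans ?_
  have := norm_nonneg u
  nlinarith [mul_nonneg hp.le this, sq_nonneg p]

theorem norm_runsDefect_succ_sub_le (hp : 0 < p) (hp1 : p ≤ 1 / 1000) (hu : ‖u‖ ≤ 4) (k : ℕ) :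
    ‖runsDefect p u (k + 1) - p ^ 2 * u‖ ≤ 4 * p ^ 3 * ‖u‖ ^ 2 := by
  have h1 := norm_div_one_add_le (norm_runsDefect_le_half hp hp1 hu k)
  have h2 := norm_runsDefect_le hp hp1 hu k
  rw [runsDefect, add_sub_cancel_left, norm_mul]
  calc _ ≤ (p * ‖u‖) * (4 * (p ^ 2 * ‖u‖)) :=
      mul_le_mul (norm_mul_one_sub_mul_le hp hp1 u) (by linarith) (norm_nonneg _) (by positivity)
    _ = _ := by ring

/-- The first-order approximation is fed back into the recursion, whose factor p(1-p)u gains one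
more order. Two steps are needed, so the index starts at 2. -/
theorem norm_runsDefect_add_two_sub_le (hp : 0 < p) (hp1 : p ≤ 1 / 1000) (hu : ‖u‖ ≤ 4) (k : ℕ) :
    ‖runsDefect p u (k + 2) - (p ^ 2 * u + p ^ 3 * (1 - p) * u ^ 2)‖ ≤ 5 * p ^ 4 * ‖u‖ ^ 3 := by
  have h1 := norm_div_one_add_sub_le (norm_runsDefect_le_half hp hp1 hu (k + 1))
  have h2 := norm_runsDefect_le hp hp1 hu (k + 1)
  have h3 := norm_runsDefect_succ_sub_le hp hp1 hu k
  set e := runsDefect p u (k + 1) with he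
  have h4 : runsDefect p u (k + 2) - (p ^ 2 * u + p ^ 3 * (1 - p) * u ^ 2) =
      p * (1 - p) * u * ((e / (1 + e) - e) + (e - p ^ 2 * u)) := by
    rw [runsDefect, ← he]; ring
  have h5 : ‖e‖ ^ 2 ≤ (2 * p ^ 2 * ‖u‖) ^ 2 := by gcongr
  have h6 : ‖(e / (1 + e) - e) + (e - p ^ 2 * u)‖ ≤ 5 * p ^ 3 * ‖u‖ ^ 2 := by
    refine (norm_add_le _ _).trans ?_
    have : p ^ 4 * ‖u‖ ^ 2 ≤ 1 / 1000 * (p ^ 3 * ‖u‖ ^ 2) := by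
      have : 0 ≤ p ^ 3 * ‖u‖ ^ 2 := by positivity
      nlinarith
    have h0 : 0 ≤ p ^ 3 * ‖u‖ ^ 2 := by positivity
    nlinarith
  rw [h4, norm_mul]
  calc _ ≤ (p * ‖u‖) * (5 * p ^ 3 * ‖u‖ ^ 2) :=
      mul_le_mul (norm_mul_one_sub_mul_le hp hp1 u) h6 (norm_nonneg _) (by positivity)
    _ = _ := by ring

theorem norm_log_one_add_runsDefect_sub_le (hp : 0 < p) (hp1 : p ≤ 1 / 1000) (hu : ‖u‖ ≤ 4)
    (k : ℕ) :
    ‖Complex.log (1 + runsDefect p u (k + 2)) -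
      (p ^ 2 * u + (p ^ 3 * (1 - p) - p ^ 4 / 2) * u ^ 2)‖ ≤ 6 * p ^ 4 * ‖u‖ ^ 3 := by
  have h1 := norm_log_one_add_sub_quadratic_le (norm_runsDefect_le_half hp hp1 hu (k + 2))
  have h2 := norm_runsDefect_le hp hp1 hu (k + 2)
  have h3 := norm_runsDefect_succ_sub_le hp hp1 hu (k + 1)
  have h4 := norm_runsDefect_add_two_sub_le hp hp1 hu k
  set e := runsDefect p u (k + 2) with he
  have h5 : ‖e‖ ^ 3 ≤ (2 * p ^ 2 * ‖u‖) ^ 3 := by gcongr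
  have hpu : ‖(p : ℂ) ^ 2 * u‖ = p ^ 2 * ‖u‖ := by
    rw [norm_mul, norm_pow, Complex.norm_real, Real.norm_of_nonneg hp.le]
  have h6 : ‖(e - p ^ 2 * u) * (e + p ^ 2 * u) / 2‖ ≤ 6 * p ^ 5 * ‖u‖ ^ 3 := by
    rw [norm_div, norm_mul]
    have : ‖e + p ^ 2 * u‖ ≤ 3 * p ^ 2 * ‖u‖ := (norm_add_le _ _).trans (by linarith)
    have h7 := mul_le_mul h3 this (norm_nonneg _) (by positivity)
    rw [Complex.norm_ofNat]
    linarith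
  have h8 : Complex.log (1 + e) - (p ^ 2 * u + (p ^ 3 * (1 - p) - p ^ 4 / 2) * u ^ 2) =
      (Complex.log (1 + e) - (e - e ^ 2 / 2)) + (e - (p ^ 2 * u + p ^ 3 * (1 - p) * u ^ 2))
        - (e - p ^ 2 * u) * (e + p ^ 2 * u) / 2 := by ring
  rw [h8]
  refine (norm_sub_le _ _).trans ((add_le_add (norm_add_le _ _) le_rfl).trans ?_)
  have h9 : 0 ≤ p ^ 4 * ‖u‖ ^ 3 := by positivity
  have h10 : p ^ 5 * ‖u‖ ^ 3 ≤ 1 / 1000 * (p ^ 4 * ‖u‖ ^ 3) := by nlinarith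
  have h11 : p ^ 6 * ‖u‖ ^ 3 ≤ 1 / 1000 * (p ^ 4 * ‖u‖ ^ 3) := by
    have : p ^ 2 ≤ 1 / 1000 := by nlinarith
    nlinarith
  nlinarith

/-- The first defect is exactly p²u. Its missing term p³(1-p)u² produces the boundary correction
-2p³(1-p) in `runsExcess`. -/
theorem norm_log_one_add_runsDefect_one_sub_le (hp : 0 < p) (hp1 : p ≤ 1 / 1000) (hu : ‖u‖ ≤ 4) :
    ‖Complex.log (1 + runsDefect p u 1) - (p ^ 2 * u - p ^ 4 / 2 * u ^ 2)‖ ≤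
      6 * p ^ 4 * ‖u‖ ^ 3 := by
  have h1 := norm_log_one_add_sub_quadratic_le (norm_runsDefect_le_half hp hp1 hu 1)
  have h2 : runsDefect p u 1 = p ^ 2 * u := by simp [runsDefect]
  have hpu : ‖(p : ℂ) ^ 2 * u‖ = p ^ 2 * ‖u‖ := by
    rw [norm_mul, norm_pow, Complex.norm_real, Real.norm_of_nonneg hp.le]
  rw [h2, hpu] at h1
  rw [h2, show (p ^ 2 * u - p ^ 4 / 2 * u ^ 2 : ℂ) = p ^ 2 * u - (p ^ 2 * u) ^ 2 / 2 by ring]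
  refine h1.trans ?_
  have h9 : 0 ≤ p ^ 4 * ‖u‖ ^ 3 := by positivity
  have : p ^ 2 ≤ 1 := by nlinarith
  calc (p ^ 2 * ‖u‖) ^ 3 = p ^ 2 * (p ^ 4 * ‖u‖ ^ 3) := by ring
    _ ≤ _ := by nlinarith

/-- Second order expansion of the logarithm of the probability generating function. -/
theorem norm_sum_log_one_add_runsDefect_sub_le (hp : 0 < p) (hp1 : p ≤ 1 / 1000) (hu : ‖u‖ ≤ 4)
    {n : ℕ} (hn : 1 ≤ n) :
    ‖∑ k ∈ Finset.range n, Complex.log (1 + runsDefect p u (k + 1)) -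
      (n * p ^ 2 * u + runsExcess n p / 2 * u ^ 2)‖ ≤ n * (6 * p ^ 4 * ‖u‖ ^ 3) := by
  induction n, hn using Nat.le_induction with
  | base =>
    have := norm_log_one_add_runsDefect_one_sub_le hp hp1 hu
    simp only [runsExcess]
    push_cast
    refine le_trans (le_of_eq ?_) (this.trans (le_of_eq ?_))
    · rw [Finset.sum_range_one]; congr 1; ring
    · ring
  | succ n hn ih =>
    obtain ⟨m, rfl⟩ := Nat.exists_eq_add_of_le' hn
    have := norm_log_one_add_runsDefect_sub_le hp hp1 hu m
    have h2 := norm_add_le_of_le ih this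
    rw [Finset.sum_range_succ]
    simp only [runsExcess] at h2 ⊢
    push_cast at h2 ⊢
    refine le_trans (le_of_eq ?_) (h2.trans (le_of_eq ?_))
    · congr 1; ring
    · ring

/-- The three-term recurrence of the probability generating functions is solved by a product. -/
theorem eq_prod_of_runs_recurrence (hp : 0 < p) (hp1 : p ≤ 1 / 1000) (hu : ‖u‖ ≤ 4) (X : ℕ → ℂ)
    (h0 : X 0 = 1) (h1 : X 1 = 1)
    (h : ∀ n, X (n + 2) = (1 + p * u) * X (n + 1) - p * (1 - p) * u * X n) (n : ℕ) :
    X (n + 1) = Complex.exp (∑ k ∈ Finset.range n, Complex.log (1 + runsDefect p u (k + 1))) := by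
  have hne (k : ℕ) : 1 + runsDefect p u k ≠ 0 := by
    have := one_half_le_norm_one_add (norm_runsDefect_le_half hp hp1 hu k)
    exact norm_pos_iff.1 (by linarith)
  -- Dividing the recurrence by X (n+1) gives the Riccati recursion of `runsDefect`; its start 0
  -- encodes X 1 = X 0.
  have hstep (n : ℕ) : X (n + 1) = (1 + runsDefect p u n) * X n := by
    induction n with
    | zero => simp [runsDefect, h0, h1]
    | succ n ih =>
      have hn : X n = X (n + 1) / (1 + runsDefect p u n) := by rw [ih]; field_simp [hne n]
      rw [h, hn, runsDefect]
      field_simp [hne n]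
      ring
  induction n with
  | zero => simp [h1]
  | succ n ih => rw [hstep, ih, Finset.sum_range_succ, Complex.exp_add, Complex.exp_log (hne _),
      mul_comm]
end

/-! ### Negative binomial: generating function, decay on circles, mass at the mean -/

theorem choose_add_sub_one_eq_Gamma {r : ℝ} (hr : 0 < r) (j : ℕ) :
    Ring.choose ((r : ℂ) + j - 1) j =
      ((Real.Gamma (r + j) / (j.factorial * Real.Gamma r) : ℝ) : ℂ) := by
  have hG : Complex.Gamma (r + j) / Complex.Gamma r = (ascPochhammer ℂ j).eval (r : ℂ) := by
    refine Complex.Gamma_add_nat_div_Gamma_eq _ fun k hk => ?_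
    have := congrArg Complex.re hk
    simp at this
    have : (0 : ℝ) ≤ k := k.cast_nonneg
    linarith
  have h1 : Ring.choose ((r : ℂ) + j - 1) j = Ring.multichoose (r : ℂ) j := by
    rw [Ring.multichoose_eq]
  have h2 := Ring.factorial_nsmul_multichoose_eq_ascPochhammer (r : ℂ) j
  rw [Polynomial.ascPochhammer_smeval_eq_eval, ← hG, nsmul_eq_mul] at h2
  have hf : (j.factorial : ℂ) ≠ 0 := by exact_mod_cast j.factorial_ne_zero
  rw [h1]
  push_cast
  rw [← Complex.Gamma_ofReal, ← Complex.Gamma_ofReal]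
  push_cast
  rw [mul_comm (j.factorial : ℂ), ← div_div, ← h2, mul_div_cancel_left₀ _ hf]

section
variable {r q : ℝ}

theorem hasSum_negBinomial (hr : 0 < r) (hq : 0 < q) {z : ℂ} (hz : ‖(1 - q) * z‖ < 1) :
    HasSum (fun j => (negBinomial r q j : ℂ) * z ^ j)
      ((q : ℂ) ^ (r : ℂ) * (1 / (1 - (1 - q) * z) ^ (r : ℂ))) := by
  have h := (Complex.one_div_one_sub_cpow_hasFPowerSeriesOnBall_zero (r : ℂ)).hasSum
    (y := (1 - q) * z) (by
      rw [Metric.mem_eball, edist_zero_right, ← ofReal_norm]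
      exact ENNReal.ofReal_lt_one.2 hz)
  rw [zero_add] at h
  convert! h.mul_left ((q : ℂ) ^ (r : ℂ)) using 2 with j
  rw [FormalMultilinearSeries.ofScalars_apply_eq, choose_add_sub_one_eq_Gamma hr, negBinomial]
  push_cast
  rw [Complex.ofReal_cpow hq.le]
  rw [smul_eq_mul, mul_pow]
  ring

/-- The negative binomial generating function as an exponential. -/
theorem negBinomial_genFun_eq_exp (hq : 0 < q) {u : ℂ} (hu : 1 - ((1 - q) / q : ℝ) * u ≠ 0) :
    (q : ℂ) ^ (r : ℂ) * (1 / (1 - (1 - q) * (1 + u)) ^ (r : ℂ)) =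
      Complex.exp (-(r * Complex.log (1 - ((1 - q) / q : ℝ) * u))) := by
  have hq0 : (q : ℂ) ≠ 0 := by exact_mod_cast hq.ne'
  have h1 : (1 - (1 - q) * (1 + u) : ℂ) = q * (1 - ((1 - q) / q : ℝ) * u) := by
    push_cast
    field_simp
    ring
  rw [h1, one_div, ← Complex.cpow_neg, Complex.cpow_def_of_ne_zero hq0,
    Complex.cpow_def_of_ne_zero (mul_ne_zero hq0 hu), ← Complex.exp_add,
    Complex.log_ofReal_mul hq hu, Complex.ofReal_log hq.le]
  congr 1
  ring

/-- The squared modulus of 1 - a exp(iθ) is (1-a)² + t with t = 2a(1 - cos θ), and 1 - cos θ ≥ θ²/5.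
The condition a ≤ 1/4 gives t ≤ 1, hence 1 + t ≥ exp(t/2). -/
theorem one_sub_cpow_norm_le {r a θ : ℝ} (hr : 0 < r) (ha : 0 < a) (ha1 : a ≤ 1 / 4)
    (hθ : |θ| ≤ Real.pi) :
    ‖1 / (1 - a * Complex.exp (θ * Complex.I)) ^ (r : ℂ)‖ ≤
      1 / (1 - a) ^ r * Real.exp (-(r * a * θ ^ 2 / 10)) := by
  have hcos := Real.cos_le_one_sub_mul_cos_sq hθ
  have hcos1 := Real.neg_one_le_cos θ
  have hpi : 1 / 5 ≤ 2 / Real.pi ^ 2 := by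
    have := Real.pi_lt_d2
    have := Real.pi_pos
    rw [div_le_div_iff₀ (by norm_num) (by positivity)]
    nlinarith
  have hc : θ ^ 2 / 5 ≤ 1 - Real.cos θ := by nlinarith [sq_nonneg θ]
  set t := 2 * a * (1 - Real.cos θ) with ht
  have ht0 : 0 ≤ t := by have := Real.cos_le_one θ; rw [ht]; nlinarith
  have ht1 : t ≤ 1 := by nlinarith
  have hn : ‖1 - a * Complex.exp (θ * Complex.I)‖ ^ 2 = (1 - a) ^ 2 + t := by
    rw [Complex.sq_norm, Complex.normSq_apply]
    simp only [Complex.sub_re, Complex.one_re, Complex.mul_re, Complex.ofReal_re,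
      Complex.exp_ofReal_mul_I_re, Complex.ofReal_im, Complex.exp_ofReal_mul_I_im,
      Complex.sub_im, Complex.one_im, Complex.mul_im]
    rw [ht]
    linear_combination a ^ 2 * Real.sin_sq_add_cos_sq θ
  have hlow : (1 - a) * Real.exp (t / 4) ≤ ‖1 - a * Complex.exp (θ * Complex.I)‖ := by
    refine le_of_sq_le_sq ?_ (norm_nonneg _)
    rw [hn, mul_pow, ← Real.exp_nat_mul]
    have h1 : Real.exp ((2 : ℕ) * (t / 4)) ≤ 1 + t := by
      have h2 := Real.one_sub_le_exp_neg (t / 2)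
      have h3 : Real.exp ((2 : ℕ) * (t / 4)) * Real.exp (-(t / 2)) = 1 := by
        rw [← Real.exp_add]; push_cast; rw [show 2 * (t / 4) + -(t / 2) = 0 by ring, Real.exp_zero]
      have h4 := Real.exp_pos ((2 : ℕ) * (t / 4))
      nlinarith
    have : (1 - a) ^ 2 ≤ 1 := by nlinarith
    nlinarith
  rw [norm_div, norm_one, Complex.norm_cpow_real, one_div, one_div]
  have hpos : 0 < (1 - a) * Real.exp (t / 4) := mul_pos (by linarith) (Real.exp_pos _)
  have h5 : ((1 - a) * Real.exp (t / 4)) ^ r ≤ ‖1 - a * Complex.exp (θ * Complex.I)‖ ^ r :=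
    Real.rpow_le_rpow hpos.le hlow hr.le
  refine (inv_anti₀ (Real.rpow_pos_of_pos hpos _) h5).trans ?_
  rw [Real.mul_rpow (by linarith) (Real.exp_pos _).le, mul_inv, ← Real.exp_mul, ← Real.exp_neg]
  have h6 : 0 ≤ ((1 - a) ^ r)⁻¹ := by
    have : 0 ≤ 1 - a := by linarith
    positivity
  refine mul_le_mul_of_nonneg_left (Real.exp_le_exp.2 ?_) h6
  have : a * θ ^ 2 / 10 ≤ t / 4 := by nlinarith
  nlinarith

theorem mul_log_sub_mul_log_le {t : ℝ} (ht : 0 < t) :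
    (t + 1) * Real.log (t + 1) - t * Real.log t - 1 ≤ Real.log (t + 1) := by
  have h1 := Real.log_le_sub_one_of_pos (show 0 < (t + 1) / t by positivity)
  rw [Real.log_div (by positivity) ht.ne'] at h1
  have h2 : (t + 1) / t - 1 = 1 / t := by field_simp; ring
  rw [h2, le_div_iff₀ ht] at h1
  nlinarith

/-- Induction on x: with t = r + x the Gamma quotient grows by t and the exponential by at most t +
1. The losses (t+1)/t telescope to (r+x)/r. -/
theorem exp_le_Gamma_add_div_Gamma (hr : 0 < r) (x : ℕ) :
    Real.exp ((r + x) * Real.log (r + x) - r * Real.log r - x) * (r / (r + x)) ≤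
      Real.Gamma (r + x) / Real.Gamma r := by
  have hG := Real.Gamma_pos_of_pos hr
  induction x with
  | zero => simp [hr.ne', hG.ne']
  | succ x ih =>
    have ht : 0 < r + x := by positivity
    have h1 : Real.Gamma (r + (x + 1 : ℕ)) = (r + x) * Real.Gamma (r + x) := by
      rw [← Real.Gamma_add_one ht.ne']; push_cast; ring_nf
    have h2 := mul_log_sub_mul_log_le ht
    have h3 : Real.exp ((r + (x + 1 : ℕ)) * Real.log (r + (x + 1 : ℕ)) - r * Real.log r -
        (x + 1 : ℕ)) ≤
        Real.exp ((r + x) * Real.log (r + x) - r * Real.log r - x) * (r + x + 1) := by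
      rw [← Real.exp_log (show 0 < r + x + 1 by positivity), ← Real.exp_add]
      refine Real.exp_le_exp.2 ?_
      push_cast
      rw [← add_assoc]
      linarith
    rw [h1, mul_div_assoc]
    refine le_trans ?_ (mul_le_mul_of_nonneg_left ih ht.le)
    refine (mul_le_mul_of_nonneg_right h3 (by positivity)).trans (le_of_eq ?_)
    push_cast
    field_simp
    ring

/-- The Stirling sequence decreases from its value e/√2 at 1. -/
theorem factorial_le_stirling {x : ℕ} (hx : 1 ≤ x) :
    (x.factorial : ℝ) ≤ Real.exp 1 * √x * (x / Real.exp 1) ^ x := by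
  obtain ⟨m, rfl⟩ := Nat.exists_eq_add_of_le' hx
  have h := Stirling.stirlingSeq'_antitone (Nat.zero_le m)
  simp only [Function.comp_apply, Nat.succ_eq_add_one, zero_add, Stirling.stirlingSeq_one] at h
  rw [Stirling.stirlingSeq, div_le_iff₀ (by positivity)] at h
  refine h.trans (le_of_eq ?_)
  rw [Real.sqrt_mul (by norm_num)]
  field_simp

/-- A negative binomial distribution with integral mean `x ≤ r` has mass of order `1 / √x`
there. -/
theorem le_negBinomial_mean {x : ℕ} (hx : 1 ≤ x) (hxr : (x : ℝ) ≤ r) :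
    1 / (2 * Real.exp 1 * √x) ≤ negBinomial r (r / (r + x)) x := by
  have hx0 : (0 : ℝ) < x := by exact_mod_cast hx
  have hr : 0 < r := hx0.trans_le hxr
  have h1 := exp_le_Gamma_add_div_Gamma hr x
  have h2 := factorial_le_stirling hx
  have hf : (0 : ℝ) < x.factorial := by exact_mod_cast x.factorial_pos
  have h3 : (r / (r + x)) ^ r * (1 - r / (r + x)) ^ x =
      Real.exp (r * Real.log r + x * Real.log x - (r + x) * Real.log (r + x)) := by
    have : 1 - r / (r + x) = x / (r + x) := by field_simp; ring
    rw [this, Real.rpow_def_of_pos (by positivity), ← Real.rpow_natCast,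
      Real.rpow_def_of_pos (by positivity), ← Real.exp_add, Real.log_div hr.ne' (by positivity),
      Real.log_div hx0.ne' (by positivity)]
    congr 1; ring
  have h4 : (x / Real.exp 1) ^ x = Real.exp (x * Real.log x - x) := by
    rw [← Real.rpow_natCast, Real.rpow_def_of_pos (by positivity),
      Real.log_div hx0.ne' (Real.exp_pos _).ne', Real.log_exp]
    congr 1; ring
  rw [h4] at h2
  have h5 : negBinomial r (r / (r + x)) x = (Real.Gamma (r + x) / Real.Gamma r) *
      ((r / (r + x)) ^ r * (1 - r / (r + x)) ^ x) / x.factorial := by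
    rw [negBinomial]
    field_simp
  have h6 : 1 / 2 ≤ r / (r + x) := by
    rw [div_le_div_iff₀ (by norm_num) (by positivity)]; linarith
  rw [h5, h3, div_le_div_iff₀ (by positivity) hf, one_mul]
  -- All logarithms of r and r + x cancel, and 1/2 bounds r/(r+x) because x ≤ r.
  have h7 : Real.exp (x * Real.log x - x) * (1 / 2) ≤ (Real.Gamma (r + x) / Real.Gamma r) *
      Real.exp (r * Real.log r + x * Real.log x - (r + x) * Real.log (r + x)) := by
    refine le_trans ?_ (mul_le_mul_of_nonneg_right h1 (Real.exp_pos _).le)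
    rw [mul_right_comm, ← Real.exp_add]
    refine le_trans (mul_le_mul_of_nonneg_left h6 (Real.exp_pos _).le) (le_of_eq ?_)
    congr 2; ring
  have h8 : 0 ≤ Real.exp 1 * √x := by positivity
  nlinarith

/-- Exponential tilting of a negative binomial distribution. -/
theorem negBinomial_mul_pow {q' ρ : ℝ} (hq : 0 < q) (hq' : 0 < q') (h : (1 - q) * ρ = 1 - q')
    (x : ℕ) :
    negBinomial r q x * ρ ^ x = q ^ r * (1 / q' ^ r) * negBinomial r q' x := by
  have h1 := (Real.rpow_pos_of_pos hq' r).ne'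
  rw [negBinomial, negBinomial, ← h, mul_pow]
  field_simp
end

/-! ### Coefficient extraction on a circle -/

theorem integral_exp_int_mul_I (m : ℤ) (hm : m ≠ 0) :
    ∫ θ in -Real.pi..Real.pi, Complex.exp ((m * Complex.I) * θ) = 0 := by
  have hc : (m * Complex.I : ℂ) ≠ 0 := mul_ne_zero (by exact_mod_cast hm) Complex.I_ne_zero
  rw [integral_exp_mul_complex hc]
  have : (m * Complex.I * (Real.pi : ℝ) : ℂ) =
      m * Complex.I * ((-Real.pi : ℝ) : ℂ) + m * (2 * Real.pi * Complex.I) := by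
    push_cast; ring
  rw [this, Complex.exp_periodic.int_mul m _, sub_self, zero_div]

/-- Cauchy's estimate for a coefficient, with the maximum replaced by an integral. -/
theorem norm_coeff_mul_pow_le {c : ℕ → ℂ} {ρ : ℝ} (hρ : 0 ≤ ρ)
    {F : ℝ → ℂ}
    (hF : ∀ θ : ℝ, HasSum (fun j => c j * (ρ * Complex.exp (θ * Complex.I)) ^ j) (F θ))
    {g : ℝ → ℝ} (hg : Continuous g) (hb : ∀ θ, |θ| ≤ Real.pi → ‖F θ‖ ≤ g θ) (x : ℕ) :
    2 * Real.pi * (‖c x‖ * ρ ^ x) ≤ ∫ θ in -Real.pi..Real.pi, g θ := by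
  have hpi := Real.pi_pos
  -- Absolute convergence at θ = 0 dominates the series on the whole circle.
  have hs : Summable fun j => ‖c j‖ * ρ ^ j := by
    simpa [Real.norm_of_nonneg hρ] using (hF 0).summable.norm
  have hterm (j : ℕ) (θ : ℝ) : c j * (ρ * Complex.exp (θ * Complex.I)) ^ j *
      Complex.exp (-(x * (θ * Complex.I))) =
      (c j * ρ ^ j) * Complex.exp ((((j - x : ℤ) : ℂ) * Complex.I) * θ) := by
    rw [mul_pow, ← Complex.exp_nat_mul, ← mul_assoc, mul_assoc _ (Complex.exp _),
      ← Complex.exp_add]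
    congr 2
    push_cast; ring
  have hsum := intervalIntegral.hasSum_integral_of_dominated_convergence (μ := volume)
    (a := -Real.pi) (b := Real.pi)
    (F := fun (j : ℕ) (θ : ℝ) => c j * (ρ * Complex.exp (θ * Complex.I)) ^ j *
      Complex.exp (-(x * (θ * Complex.I))))
    (f := fun θ => F θ * Complex.exp (-(x * (θ * Complex.I))))
    (fun j _ => ‖c j‖ * ρ ^ j)
    (fun j => (by fun_prop : Continuous _).aestronglyMeasurable)
    (fun j => Eventually.of_forall fun θ _ => by
      rw [hterm, norm_mul]
      have : ‖Complex.exp ((((j - x : ℤ) : ℂ) * Complex.I) * θ)‖ = 1 := by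
        have : ((((j - x : ℤ) : ℂ) * Complex.I) * θ) = (((j - x : ℤ) * θ : ℝ) : ℂ) * Complex.I := by
          push_cast; ring
        rw [this, Complex.norm_exp_ofReal_mul_I]
      rw [this, mul_one, norm_mul, norm_pow, Complex.norm_real, Real.norm_of_nonneg hρ])
    (Eventually.of_forall fun θ _ => hs)
    (by simp)
    (Eventually.of_forall fun θ _ => (hF θ).mul_right _)
  have hint (j : ℕ) : ∫ θ in -Real.pi..Real.pi, c j * (ρ * Complex.exp (θ * Complex.I)) ^ j *
      Complex.exp (-(x * (θ * Complex.I))) = if j = x then 2 * Real.pi * (c x * ρ ^ x) else 0 := by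
    simp_rw [hterm]
    rw [intervalIntegral.integral_const_mul]
    split_ifs with h
    · subst h
      simp
      ring
    · rw [integral_exp_int_mul_I _ (by omega), mul_zero]
  simp_rw [hint] at hsum
  have heq := hsum.unique (hasSum_ite_eq x _)
  have h1 : ‖∫ θ in -Real.pi..Real.pi, F θ * Complex.exp (-(x * (θ * Complex.I)))‖ ≤
      ∫ θ in -Real.pi..Real.pi, g θ := by
    refine intervalIntegral.norm_integral_le_of_norm_le (by linarith) ?_
      (hg.intervalIntegrable _ _)
    refine Eventually.of_forall fun θ hθ => ?_
    have : ‖Complex.exp (-(x * (θ * Complex.I)))‖ = 1 := by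
      have : (-(x * (θ * Complex.I)) : ℂ) = ((-(x * θ) : ℝ) : ℂ) * Complex.I := by
        push_cast; ring
      rw [this, Complex.norm_exp_ofReal_mul_I]
    rw [norm_mul, this, mul_one]
    exact hb θ (abs_le.2 ⟨hθ.1.le, hθ.2⟩)
  rw [heq] at h1
  refine le_trans (le_of_eq ?_) h1
  simp [Real.norm_of_nonneg hρ, abs_of_pos hpi]

/-! ### Generating function of the 2-runs statistic -/

/-- The Bernoulli weights. -/
noncomputable def bernoulliWeight (p : ℝ) (d : Fin 2) : ℝ := if d = 0 then 1 - p else p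

/-- The probability generating function of the number of 2-runs in `c, b 0, …, b (n - 1)`, where
`b` consists of independent Bernoulli variables. -/
noncomputable def runsGenFun (p : ℝ) (z : ℂ) (n : ℕ) (c : Fin 2) : ℂ :=
  ∑ b : Fin n → Fin 2, (∏ i, (bernoulliWeight p (b i) : ℂ)) *
    z ^ (∑ i : Fin n, ((Fin.cons c b : Fin (n + 1) → Fin 2) i.castSucc : ℕ) * (b i : ℕ))

theorem sum_fin_succ_pi {M : Type*} [AddCommMonoid M] {n : ℕ} (f : (Fin (n + 1) → Fin 2) → M) :
    ∑ b, f b = ∑ d : Fin 2, ∑ b : Fin n → Fin 2, f (Fin.cons d b) := by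
  rw [← (Fin.consEquiv (fun _ => Fin 2)).sum_comp, Fintype.sum_prod_type]
  rfl

section
variable {p : ℝ}

theorem runsGenFun_zero (z : ℂ) (c : Fin 2) : runsGenFun p z 0 c = 1 := by
  simp [runsGenFun]

theorem runsGenFun_succ (z : ℂ) (n : ℕ) (c : Fin 2) :
    runsGenFun p z (n + 1) c =
      ∑ d : Fin 2, bernoulliWeight p d * z ^ ((c : ℕ) * (d : ℕ)) * runsGenFun p z n d := by
  rw [runsGenFun, sum_fin_succ_pi]
  refine Finset.sum_congr rfl fun d _ => ?_
  rw [runsGenFun, Finset.mul_sum]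
  refine Finset.sum_congr rfl fun b _ => ?_
  rw [Fin.prod_univ_succ, Fin.sum_univ_succ]
  simp only [Fin.cons_zero, Fin.cons_succ, Fin.castSucc_zero, ← Fin.succ_castSucc]
  rw [pow_add]
  ring

/-- Cayley–Hamilton for the 2×2 transfer matrix, of trace 1 + pu and determinant p(1-p)u: the
functions started at 1 are eliminated. -/
theorem runsGenFun_add_two (u : ℂ) (n : ℕ) :
    runsGenFun p (1 + u) (n + 2) 0 =
      (1 + p * u) * runsGenFun p (1 + u) (n + 1) 0 - p * (1 - p) * u * runsGenFun p (1 + u) n 0 := by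
  have h1 := runsGenFun_succ (p := p) (1 + u) (n + 1) 0
  have h2 := runsGenFun_succ (p := p) (1 + u) n 0
  have h3 := runsGenFun_succ (p := p) (1 + u) n 1
  simp only [Fin.sum_univ_two, bernoulliWeight] at h1 h2 h3
  simp at h1 h2 h3
  linear_combination h1 + p * h3 - (p + p * u) * h2

variable {Ω : Type*} [MeasurableSpace Ω] {μ : Measure Ω}

theorem IsIIDBernoulli.measureReal_eq_pattern {ι : Type*} [Fintype ι] {η : ι → Ω → ℕ}
    (h : IsIIDBernoulli μ η p) (b : ι → Fin 2) :
    μ.real {ω | ∀ i, η i ω = b i} = ∏ i, bernoulliWeight p (b i) := by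
  have h1 := h.indep.measure_inter_preimage_eq_mul Finset.univ (sets := fun i => {((b i : ℕ))})
    (fun i _ => measurableSet_singleton _)
  have h2 : {ω | ∀ i, η i ω = b i} = ⋂ i ∈ Finset.univ, η i ⁻¹' {((b i : ℕ))} := by
    ext ω; simp
  rw [measureReal_def, h2, h1, ENNReal.toReal_prod]
  refine Finset.prod_congr rfl fun i _ => ?_
  have h3 : ∀ d : Fin 2, (μ (η i ⁻¹' {(d : ℕ)})).toReal = bernoulliWeight p d := by
    intro d
    fin_cases d
    · exact h.prob_zero i
    · exact h.prob_one i
  exact h3 (b i)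

variable [IsProbabilityMeasure μ]

theorem IsIIDBernoulli.ae_lt_two {ι : Type*} [Countable ι] {η : ι → Ω → ℕ}
    (h : IsIIDBernoulli μ η p) : ∀ᵐ ω ∂μ, ∀ i, η i ω < 2 := by
  rw [ae_all_iff]
  intro i
  have hm0 : MeasurableSet {ω | η i ω = 0} := h.measurable i (measurableSet_singleton 0)
  have hm1 : MeasurableSet {ω | η i ω = 1} := h.measurable i (measurableSet_singleton 1)
  have h1 : μ.real ({ω | η i ω = 0} ∪ {ω | η i ω = 1}) = 1 := by
    rw [measureReal_union _ hm1, h.prob_zero, h.prob_one]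
    · ring
    · rw [Set.disjoint_left]
      intro ω h0 h1
      simp at h0 h1
      omega
  have h2 : μ ({ω | η i ω = 0} ∪ {ω | η i ω = 1}) = 1 := by
    rwa [measureReal_def, ENNReal.toReal_eq_one_iff] at h1
  have h3 := (prob_compl_eq_zero_iff (hm0.union hm1)).2 h2
  filter_upwards [compl_mem_ae_iff.2 h3] with ω hω
  simp at hω
  omega

theorem IsIIDBernoulli.measureReal_twoRuns {n : ℕ} {η : Fin (n + 1) → Ω → ℕ}
    (h : IsIIDBernoulli μ η p) (j : ℕ) :
    μ.real {ω | twoRuns η ω = j} = ∑ b : Fin (n + 1) → Fin 2,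
      if j = ∑ i : Fin n, (b i.castSucc : ℕ) * (b i.succ : ℕ) then ∏ i, bernoulliWeight p (b i)
      else 0 := by
  rw [← Finset.sum_filter]
  have hae : {ω | twoRuns η ω = j} =ᵐ[μ] ⋃ b ∈ Finset.univ.filter (fun b : Fin (n + 1) → Fin 2 =>
      j = ∑ i : Fin n, (b i.castSucc : ℕ) * (b i.succ : ℕ)), {ω | ∀ i, η i ω = b i} := by
    filter_upwards [h.ae_lt_two] with ω hω
    refine propext ?_
    change ω ∈ {ω | twoRuns η ω = j} ↔ ω ∈ (⋃ b ∈ Finset.univ.filter (fun b : Fin (n + 1) → Fin 2 =>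
      j = ∑ i : Fin n, (b i.castSucc : ℕ) * (b i.succ : ℕ)), {ω | ∀ i, η i ω = b i})
    simp only [Set.mem_ofPred_eq, Finset.mem_filter, Finset.mem_univ, true_and, Set.mem_iUnion,
      exists_prop]
    constructor
    · intro hj
      exact ⟨fun i => ⟨η i ω, hω i⟩, hj.symm, fun i => rfl⟩
    · rintro ⟨b, hb, hη⟩
      rw [hb, twoRuns]
      simp [hη]
  rw [measureReal_congr hae, measureReal_biUnion_finset]
  · exact Finset.sum_congr rfl fun b _ => h.measureReal_eq_pattern b
  · intro b _ b' _ hbb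
    rw [Function.onFun, Set.disjoint_left]
    intro ω h1 h2
    exact hbb (funext fun i => Fin.ext ((h1 i).symm.trans (h2 i)))
  · intro b _
    rw [Set.ofPred_forall]
    exact MeasurableSet.iInter fun i => h.measurable i (measurableSet_singleton _)

/-- The probability generating function of the 2-runs statistic. -/
theorem IsIIDBernoulli.hasSum_twoRuns {n : ℕ} {η : Fin (n + 1) → Ω → ℕ}
    (h : IsIIDBernoulli μ η p) (z : ℂ) :
    HasSum (fun j => (μ.real {ω | twoRuns η ω = j} : ℂ) * z ^ j) (runsGenFun p z (n + 1) 0) := by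
  -- A fictitious initial 0 creates no run, so n + 1 variables with n products fit `runsGenFun` at n
  -- + 1.
  have hG : runsGenFun p z (n + 1) 0 = ∑ b : Fin (n + 1) → Fin 2,
      ((∏ i, bernoulliWeight p (b i) : ℝ) : ℂ) *
        z ^ (∑ i : Fin n, (b i.castSucc : ℕ) * (b i.succ : ℕ)) := by
    rw [runsGenFun]
    refine Finset.sum_congr rfl fun b _ => ?_
    rw [Fin.sum_univ_succ]
    simp
  rw [hG]
  have hs := hasSum_sum (s := Finset.univ) fun (b : Fin (n + 1) → Fin 2) _ =>
    hasSum_ite_eq (∑ i : Fin n, (b i.castSucc : ℕ) * (b i.succ : ℕ))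
      (((∏ i, bernoulliWeight p (b i) : ℝ) : ℂ) *
        z ^ (∑ i : Fin n, (b i.castSucc : ℕ) * (b i.succ : ℕ)))
  convert! hs using 2 with j
  rw [h.measureReal_twoRuns, Complex.ofReal_sum, Finset.sum_mul]
  refine Finset.sum_congr rfl fun b _ => ?_
  split_ifs with hj
  · rw [← hj]
  · simp
end

/-! ### Comparison of generating functions and local limit theorem with a rate -/

section
variable {n : ℕ} {p : ℝ}

theorem runsExcess_pos (hn : 2 ≤ n) (hp : 0 < p) (hp1 : p ≤ 1 / 1000) : 0 < runsExcess n p := by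
  have hn' : (2 : ℝ) ≤ n := by exact_mod_cast hn
  have : runsExcess n p = p ^ 3 * (n * (2 - 3 * p) - 2 * (1 - p)) := by rw [runsExcess]; ring
  rw [this]
  have : 0 < n * (2 - 3 * p) - 2 * (1 - p) := by nlinarith
  positivity

theorem runsExcess_le (hp : 0 < p) (hp1 : p ≤ 1 / 1000) :
    runsExcess n p ≤ 2 * (n * p ^ 3) := by
  rw [runsExcess]
  have h1 : 0 ≤ n * p ^ 3 * (3 * p) := by positivity
  have h2 : 0 ≤ 2 * p ^ 3 * (1 - p) := by
    have : 0 ≤ 1 - p := by linarith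
    positivity
  nlinarith

theorem runsQbar_eq (hn : 2 ≤ n) (hp : 0 < p) (hp1 : p ≤ 1 / 1000) :
    runsQbar n p = n * p ^ 2 / (n * p ^ 2 + runsExcess n p) := by
  have := runsExcess_pos hn hp hp1
  have : 0 < n * p ^ 2 + runsExcess n p := by positivity
  rw [runsQbar, runsPbar]
  field_simp
  ring

theorem one_sub_runsQbar_div (hn : 2 ≤ n) (hp : 0 < p) (hp1 : p ≤ 1 / 1000) :
    (1 - runsQbar n p) / runsQbar n p = runsExcess n p / (n * p ^ 2) := by
  have hE := runsExcess_pos hn hp hp1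
  have hn' : (0 : ℝ) < n := by exact_mod_cast (show 0 < n by omega)
  have : 0 < n * p ^ 2 + runsExcess n p := by positivity
  rw [runsQbar_eq hn hp hp1]
  field_simp
  ring

/-- The generating functions of the 2-runs statistic and of the matching negative binomial
distribution agree up to a factor whose logarithm vanishes to third order at `1`. -/
theorem exists_runsGenFun_eq_mul_exp (hn : 2 ≤ n) (hp : 0 < p) (hp1 : p ≤ 1 / 1000) {u : ℂ}
    (hu : ‖u‖ ≤ 4) : ∃ D : ℂ, ‖D‖ ≤ 10 * (n * p ^ 4 * ‖u‖ ^ 3) ∧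
      runsGenFun p (1 + u) (n + 1) 0 = (runsQbar n p : ℂ) ^ (runsR n p : ℂ) *
        (1 / (1 - (1 - runsQbar n p) * (1 + u)) ^ (runsR n p : ℂ)) * Complex.exp D := by
  have hE := runsExcess_pos hn hp hp1
  have hE2 := runsExcess_le (n := n) hp hp1
  have hn' : (0 : ℝ) < n := by exact_mod_cast (show 0 < n by omega)
  set E := runsExcess n p with hEdef
  have hq : 0 < runsQbar n p := by rw [runsQbar_eq hn hp hp1]; positivity
  set κ := E / (n * p ^ 2) with hκ
  have hκ0 : 0 < κ := by positivity
  have hκ2 : κ ≤ 2 * p := by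
    rw [hκ, div_le_iff₀ (by positivity)]; nlinarith
  have hκu : ‖-((κ : ℂ) * u)‖ = κ * ‖u‖ := by
    rw [norm_neg, norm_mul, Complex.norm_real, Real.norm_of_nonneg hκ0.le]
  have hκu2 : κ * ‖u‖ ≤ 1 / 2 := by nlinarith [norm_nonneg u]
  have hne : 1 - (κ : ℂ) * u ≠ 0 := by
    have := one_half_le_norm_one_add (hκu.trans_le hκu2)
    rw [← sub_eq_add_neg] at this
    exact norm_pos_iff.1 (by linarith)
  have hH := negBinomial_genFun_eq_exp (r := runsR n p) hq (u := u)
    (by rwa [one_sub_runsQbar_div hn hp hp1])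
  rw [one_sub_runsQbar_div hn hp hp1, ← hEdef, ← hκ] at hH
  have hG := eq_prod_of_runs_recurrence hp hp1 hu (fun k => runsGenFun p (1 + u) k 0)
    (runsGenFun_zero _ _) (by
      simp [runsGenFun_succ, runsGenFun_zero, bernoulliWeight])
    (runsGenFun_add_two u) n
  have hGe := norm_sum_log_one_add_runsDefect_sub_le hp hp1 hu (show 1 ≤ n by omega)
  have hHe := norm_log_one_add_sub_quadratic_le (hκu.trans_le hκu2)
  rw [← sub_eq_add_neg, hκu] at hHe
  beta_reduce at hG
  rw [hG, hH]
  set L := ∑ k ∈ Finset.range n, Complex.log (1 + runsDefect p u (k + 1))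
  set M := Complex.log (1 - (κ : ℂ) * u)
  refine ⟨L + runsR n p * M, ?_, ?_⟩
  · have hr1 : runsR n p * κ = n * p ^ 2 := by
      rw [runsR, hκ, ← hEdef]; field_simp
    have hr2 : runsR n p * κ ^ 2 = E := by
      rw [runsR, hκ, ← hEdef]; field_simp
    have hr : 0 < runsR n p := by rw [runsR]; positivity
    -- This 4, with the 6 from the runs side, makes the constant 10.
    have hr3 : runsR n p * κ ^ 3 ≤ 4 * (n * p ^ 4) := by
      calc runsR n p * κ ^ 3 = E * κ := by rw [← hr2]; ring
        _ ≤ (2 * (n * p ^ 3)) * (2 * p) := mul_le_mul hE2 hκ2 hκ0.le (by positivity)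
        _ = _ := by ring
    have hr1' : (runsR n p : ℂ) * κ = n * p ^ 2 := by exact_mod_cast hr1
    have hr2' : (runsR n p : ℂ) * κ ^ 2 = E := by exact_mod_cast hr2
    have hdec : L + runsR n p * M = (L - (n * p ^ 2 * u + E / 2 * u ^ 2)) +
        runsR n p * (M - (-(κ * u) - (-(κ * u)) ^ 2 / 2)) := by
      linear_combination (-u) * hr1' - u ^ 2 / 2 * hr2'
    rw [hdec]
    refine (norm_add_le_of_le hGe (le_of_eq (norm_mul _ _))).trans ?_
    rw [Complex.norm_real, Real.norm_of_nonneg hr.le]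
    have h1 := mul_le_mul_of_nonneg_left hHe hr.le
    have h2 := mul_le_mul_of_nonneg_right hr3 (show 0 ≤ ‖u‖ ^ 3 by positivity)
    rw [mul_pow, ← mul_assoc] at h1
    linarith
  · rw [← Complex.exp_add]; congr 1; ring

theorem norm_exp_sub_one_le_mul_exp (D : ℂ) : ‖Complex.exp D - 1‖ ≤ ‖D‖ * Real.exp ‖D‖ := by
  simpa using Complex.norm_exp_sub_sum_le_norm_mul_exp D 1

theorem norm_mul_exp_sub_one_le (ρ θ : ℝ) :
    ‖(ρ : ℂ) * Complex.exp (θ * Complex.I) - 1‖ ≤ |ρ - 1| + |θ| := by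
  have h : (ρ : ℂ) * Complex.exp (θ * Complex.I) - 1 =
      ((ρ - 1 : ℝ) : ℂ) * Complex.exp (θ * Complex.I) + (Complex.exp (Complex.I * θ) - 1) := by
    rw [mul_comm Complex.I]; push_cast; ring
  rw [h]
  refine norm_add_le_of_le ?_ ?_
  · rw [norm_mul, Complex.norm_exp_ofReal_mul_I, mul_one, Complex.norm_real, Real.norm_eq_abs]
  · simpa using Real.norm_exp_I_mul_ofReal_sub_one_le (x := θ)

/-- The decay splits as 1/20 = 1/40 + 1/80 + 1/80: one share pays for exp B, one for the factor
linear in y, and one remains to be integrated. -/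
theorem gaussian_tail_absorb {a b B y : ℝ} (hy : 0 ≤ y) (ha : 0 ≤ a) (hb : 0 ≤ b) (ha1 : a ≤ 40)
    (hb1 : b ≤ 1 / 40) (hB : B ≤ a + b * y) :
    Real.exp (-(y / 20)) * (B * Real.exp B) ≤ Real.exp 40 * (a + 80 * b) * Real.exp (-(y / 80)) := by
  have h1 : Real.exp B ≤ Real.exp 40 * Real.exp (y / 40) := by
    rw [← Real.exp_add]
    exact Real.exp_le_exp.2 (by nlinarith)
  have h2 : y / 80 ≤ Real.exp (y / 80) := by linarith [Real.add_one_le_exp (y / 80)]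
  have h3 : 1 ≤ Real.exp (y / 80) := Real.one_le_exp (by positivity)
  have h4 : B ≤ (a + 80 * b) * Real.exp (y / 80) := by nlinarith
  have h5 : B * Real.exp B ≤ ((a + 80 * b) * Real.exp (y / 80)) *
      (Real.exp 40 * Real.exp (y / 40)) :=
    mul_le_mul h4 h1 (Real.exp_pos _).le (by positivity)
  refine (mul_le_mul_of_nonneg_left h5 (Real.exp_pos _).le).trans (le_of_eq ?_)
  have h6 : Real.exp (-(y / 80)) = Real.exp (-(y / 20)) * Real.exp (y / 80) * Real.exp (y / 40) := by
    rw [← Real.exp_add, ← Real.exp_add]; congr 1; ring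
  rw [h6]; ring

theorem integral_gaussian_le {b C : ℝ} (hb : 0 < b) (hC : 0 ≤ C) :
    ∫ θ in -Real.pi..Real.pi, C * Real.exp (-b * θ ^ 2) ≤ C * √(Real.pi / b) := by
  have := Real.pi_pos
  rw [intervalIntegral.integral_const_mul, ← integral_gaussian,
    intervalIntegral.integral_of_le (by linarith)]
  exact mul_le_mul_of_nonneg_left (setIntegral_le_integral (integrable_exp_neg_mul_sq hb)
    (Eventually.of_forall fun _ => (Real.exp_pos _).le)) hC

theorem abs_tilt_sub_one_le {x : ℕ} {l E : ℝ} (hl : 0 < l) (hE : 0 < E) :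
    |((x : ℝ) / (l ^ 2 / E + x)) / (E / (l + E)) - 1| ≤ |(x : ℝ) - l| / l := by
  have h0 : 0 < l ^ 2 + x * E := by positivity
  have h1 : ((x : ℝ) / (l ^ 2 / E + x)) / (E / (l + E)) - 1 =
      ((x : ℝ) - l) / l * (l ^ 2 / (l ^ 2 + x * E)) := by
    field_simp
    ring
  rw [h1, abs_mul, abs_div, abs_of_pos hl]
  refine mul_le_of_le_one_right (by positivity) ?_
  rw [abs_of_pos (by positivity), div_le_one h0]
  have : 0 ≤ x * E := by positivity
  linarith

set_option maxHeartbeats 1000000 in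
/-- The local limit theorem with an explicit rate. -/
theorem IsIIDBernoulli.abs_measureReal_twoRuns_sub_negBinomial_le {Ω : Type*} [MeasurableSpace Ω]
    {μ : Measure Ω} [IsProbabilityMeasure μ] {η : Fin (n + 1) → Ω → ℕ}
    (h : IsIIDBernoulli μ η p) (hn : 2 ≤ n) (hp : 0 < p) (hp1 : p ≤ 1 / 1000) {x : ℕ}
    (hx : |(x : ℝ) - n * p ^ 2| ≤ n * p ^ 2 / 2)
    (hτ : |(x : ℝ) - n * p ^ 2| ^ 3 * p ^ 2 / (n * p ^ 2) ^ 2 ≤ 1) :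
    0 < negBinomial (runsR n p) (runsQbar n p) x ∧
    |μ.real {ω | twoRuns η ω = x} - negBinomial (runsR n p) (runsQbar n p) x| ≤
      Real.exp 40 * 25600 * (√(80 * Real.pi) * Real.exp 1) *
        (|(x : ℝ) - n * p ^ 2| ^ 3 * p ^ 2 / (n * p ^ 2) ^ 2 + p ^ 2) *
          negBinomial (runsR n p) (runsQbar n p) x := by
  have hE := runsExcess_pos hn hp hp1
  have hE2 := runsExcess_le (n := n) hp hp1
  have hn' : (0 : ℝ) < n := by exact_mod_cast (show 0 < n by omega)
  have hQ := runsQbar_eq hn hp hp1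
  set q := runsQbar n p with hq_def
  set r := runsR n p with hr_def
  set E := runsExcess n p with hE_def
  set l := (n : ℝ) * p ^ 2 with hl_def
  set τ := |(x : ℝ) - l| ^ 3 * p ^ 2 / l ^ 2 with hτ_def
  have hl : 0 < l := by positivity
  have hτ0 : 0 ≤ τ := by positivity
  have hR : r = l ^ 2 / E := by rw [hr_def, runsR, ← hE_def, hl_def]; ring
  have hr : 0 < r := by rw [hR]; positivity
  have hxl := abs_le.1 hx
  have hx0 : (0 : ℝ) < x := by linarith
  have hx1 : 1 ≤ x := by exact_mod_cast hx0
  have hEl : E ≤ 2 * p * l := by rw [hl_def]; nlinarith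
  have hrl : 2 * l ≤ r := by
    rw [hR, le_div_iff₀ hE]
    nlinarith
  have hxr : (x : ℝ) ≤ r := by linarith
  have hq : 0 < q := by rw [hQ]; positivity
  have hq1 : 1 - q = E / (l + E) := by rw [hQ]; field_simp; ring
  have hq10 : 0 < 1 - q := by rw [hq1]; positivity
  -- NB(r, q') has mean exactly x; ρ below is the tilt carrying q to q', and the radius of the
  -- circle.
  set q' := r / (r + x) with hq'_def
  have hq' : 0 < q' := by positivity
  have hq1' : 1 - q' = x / (r + x) := by rw [hq'_def]; field_simp; ring
  set ρ := (1 - q') / (1 - q) with hρ_def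
  have hρ : 0 < ρ := by
    rw [hρ_def, hq1']; positivity
  have hρq : (1 - q) * ρ = 1 - q' := by rw [hρ_def]; field_simp
  have hρ1 : |ρ - 1| ≤ |(x : ℝ) - l| / l := by
    rw [hρ_def, hq1', hq1, hR]; exact abs_tilt_sub_one_le hl hE
  have hρ2 : |ρ - 1| ≤ 1 / 2 := hρ1.trans (by rw [div_le_iff₀ hl]; linarith)
  have hp' : 1 - q' ≤ 1 / 4 := by
    rw [← hρq, hq1]
    have h1 : E / (l + E) ≤ 2 * p := by
      rw [div_le_iff₀ (by positivity)]; nlinarith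
    have h2 : ρ ≤ 3 / 2 := by linarith [(abs_le.1 hρ2).2]
    have h3 : E / (l + E) * ρ ≤ (2 * p) * (3 / 2) := mul_le_mul h1 h2 hρ.le (by positivity)
    linarith
  have hp'0 : 0 < 1 - q' := by rw [hq1']; positivity
  have hrp' : (x : ℝ) / 2 ≤ r * (1 - q') := by
    rw [hq1', ← mul_div_assoc, div_le_div_iff₀ (by norm_num) (by positivity)]
    nlinarith
  set H0 := q ^ r * (1 / q' ^ r) with hH0_def
  have hH0 : 0 < H0 := by
    have := Real.rpow_pos_of_pos hq r
    have := Real.rpow_pos_of_pos hq' r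
    positivity
  have htilt := negBinomial_mul_pow (r := r) hq hq' hρq x
  rw [← hH0_def] at htilt
  have hmean := le_negBinomial_mean hx1 hxr
  rw [← hq'_def] at hmean
  have hsx : 0 < √(x : ℝ) := Real.sqrt_pos.2 hx0
  have hρx : 0 < ρ ^ x := by positivity
  have hb0 : 0 < negBinomial r q x := by
    have h1 : 0 < negBinomial r q' x := lt_of_lt_of_le (by positivity) hmean
    have h2 : 0 < negBinomial r q x * ρ ^ x := by rw [htilt]; positivity
    exact pos_of_mul_pos_left h2 hρx.le
  refine ⟨hb0, ?_⟩
  have hz (θ : ℝ) : ((1 - q : ℂ)) * (ρ * Complex.exp (θ * Complex.I)) =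
      ((1 - q' : ℝ) : ℂ) * Complex.exp (θ * Complex.I) := by
    rw [← hρq]; push_cast; ring
  set H : ℝ → ℂ := fun θ => (q : ℂ) ^ (r : ℂ) *
    (1 / (1 - ((1 - q' : ℝ) : ℂ) * Complex.exp (θ * Complex.I)) ^ (r : ℂ)) with hH_def
  have hHsum (θ : ℝ) : HasSum (fun j => (negBinomial r q j : ℂ) *
      (ρ * Complex.exp (θ * Complex.I)) ^ j) (H θ) := by
    have h1 := hasSum_negBinomial hr hq (z := ρ * Complex.exp (θ * Complex.I)) (by
      rw [hz, norm_mul, Complex.norm_exp_ofReal_mul_I, mul_one, Complex.norm_real,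
        Real.norm_of_nonneg hp'0.le]
      linarith)
    rwa [hz] at h1
  have hHnorm (θ : ℝ) (hθ : |θ| ≤ Real.pi) : ‖H θ‖ ≤ H0 * Real.exp (-(x * θ ^ 2 / 20)) := by
    have h1 := one_sub_cpow_norm_le hr hp'0 hp' hθ
    rw [sub_sub_cancel] at h1
    rw [hH_def]
    beta_reduce
    rw [norm_mul, Complex.norm_cpow_real, Complex.norm_real, Real.norm_of_nonneg hq.le, hH0_def,
      mul_assoc]
    refine mul_le_mul_of_nonneg_left (h1.trans ?_) (Real.rpow_nonneg hq.le _)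
    refine mul_le_mul_of_nonneg_left (Real.exp_le_exp.2 ?_)
      (one_div_nonneg.2 (Real.rpow_nonneg hq'.le _))
    have h2 := mul_le_mul_of_nonneg_right hrp' (sq_nonneg θ)
    linarith
  set K := Real.exp 40 * (40 * τ + 80 * (320 * p ^ 2)) with hK_def
  have hK : 0 ≤ K := by positivity
  have hbound (θ : ℝ) (hθ : |θ| ≤ Real.pi) :
      ‖runsGenFun p (ρ * Complex.exp (θ * Complex.I)) (n + 1) 0 - H θ‖ ≤
        (H0 * K) * Real.exp (-(x / 80) * θ ^ 2) := by
    have hpi := Real.pi_lt_d2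
    have hθ0 := abs_nonneg θ
    set u : ℂ := ρ * Complex.exp (θ * Complex.I) - 1 with hu_def
    have hun : ‖u‖ ≤ |ρ - 1| + |θ| := norm_mul_exp_sub_one_le ρ θ
    obtain ⟨D, hD, hGD⟩ := exists_runsGenFun_eq_mul_exp hn hp hp1 (u := u) (by linarith)
    have hu1 : 1 + u = ρ * Complex.exp (θ * Complex.I) := by rw [hu_def]; ring
    rw [hu1, ← hq_def, ← hr_def, hz] at hGD
    have hGD' : runsGenFun p (ρ * Complex.exp (θ * Complex.I)) (n + 1) 0 - H θ =
        H θ * (Complex.exp D - 1) := by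
      rw [hGD, hH_def]; ring
    -- For s, t ≥ 0, 4(s³ + t³) - (s + t)³ = 3(s + t)(s - t)².
    have hu3 : ‖u‖ ^ 3 ≤ 4 * (|ρ - 1| ^ 3 + |θ| ^ 3) := by
      refine (pow_le_pow_left₀ (norm_nonneg _) hun 3).trans ?_
      have := abs_nonneg (ρ - 1)
      nlinarith [mul_nonneg (add_nonneg this hθ0) (sq_nonneg (|ρ - 1| - |θ|))]
    have hτρ : l * p ^ 2 * |ρ - 1| ^ 3 ≤ τ := by
      have h1 := pow_le_pow_left₀ (abs_nonneg _) hρ1 3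
      refine (mul_le_mul_of_nonneg_left h1 (by positivity)).trans (le_of_eq ?_)
      rw [hτ_def]; field_simp
    -- Since |θ| ≤ π < 4, one power of |θ| is given up: the cubic error becomes a small multiple of
    -- xθ², which the Gaussian absorbs.
    have hθ3 : l * p ^ 2 * |θ| ^ 3 ≤ 8 * p ^ 2 * (x * θ ^ 2) := by
      have h1 : |θ| ^ 3 ≤ 4 * θ ^ 2 := by
        rw [← sq_abs θ]
        nlinarith [sq_nonneg |θ|]
      have h2 : l ≤ 2 * x := by linarith
      calc l * p ^ 2 * |θ| ^ 3 ≤ (2 * x) * p ^ 2 * (4 * θ ^ 2) := by gcongr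
        _ = _ := by ring
    have hDle : ‖D‖ ≤ 40 * τ + 320 * p ^ 2 * (x * θ ^ 2) := by
      have h1 : (n : ℝ) * p ^ 4 * ‖u‖ ^ 3 ≤ l * p ^ 2 * (4 * (|ρ - 1| ^ 3 + |θ| ^ 3)) := by
        refine (mul_le_mul_of_nonneg_left hu3 (by positivity)).trans (le_of_eq ?_)
        rw [hl_def]; ring
      linarith
    have habs := gaussian_tail_absorb (y := x * θ ^ 2) (by positivity)
      (show 0 ≤ 40 * τ by positivity) (show 0 ≤ 320 * p ^ 2 by positivity) (by linarith)
      (by nlinarith) hDle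
    rw [hGD', norm_mul]
    calc ‖H θ‖ * ‖Complex.exp D - 1‖
        ≤ (H0 * Real.exp (-(x * θ ^ 2 / 20))) * (‖D‖ * Real.exp ‖D‖) :=
          mul_le_mul (hHnorm θ hθ) (norm_exp_sub_one_le_mul_exp D) (norm_nonneg _) (by positivity)
      _ ≤ H0 * (K * Real.exp (-(x * θ ^ 2 / 80))) := by
          rw [mul_assoc]; exact mul_le_mul_of_nonneg_left habs hH0.le
      _ = _ := by rw [show -(x / 80 : ℝ) * θ ^ 2 = -(x * θ ^ 2 / 80) by ring]; ring
  have hcoef := norm_coeff_mul_pow_le (ρ := ρ) hρ.le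
    (c := fun j => (μ.real {ω | twoRuns η ω = j} : ℂ) - (negBinomial r q j : ℂ))
    (F := fun θ => runsGenFun p (ρ * Complex.exp (θ * Complex.I)) (n + 1) 0 - H θ)
    (fun θ => by
      simp_rw [sub_mul]
      exact (h.hasSum_twoRuns _).sub (hHsum θ))
    (g := fun θ => (H0 * K) * Real.exp (-(x / 80) * θ ^ 2)) (by fun_prop) hbound x
  beta_reduce at hcoef
  rw [← Complex.ofReal_sub, Complex.norm_real, Real.norm_eq_abs] at hcoef
  have hint := hcoef.trans (integral_gaussian_le (by positivity) (by positivity))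
  set δ := |μ.real {ω | twoRuns η ω = x} - negBinomial r q x| with hδ
  have hδ0 : 0 ≤ δ := abs_nonneg _
  have hsq : √(Real.pi / (x / 80)) = √(80 * Real.pi) / √x := by
    rw [← Real.sqrt_div (by positivity)]; congr 1; field_simp
  rw [hsq] at hint
  -- The Stirling lower bound turns the integral's size H0/√x into a multiple of the tilted mass,
  -- making the error relative.
  have hHb : H0 / √x ≤ 2 * Real.exp 1 * (negBinomial r q x * ρ ^ x) := by
    rw [htilt]
    have h1 := mul_le_mul_of_nonneg_left hmean (show 0 ≤ 2 * Real.exp 1 * H0 by positivity)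
    refine le_trans (le_of_eq ?_) (h1.trans (le_of_eq (by ring)))
    field_simp
  have hKle : K ≤ Real.exp 40 * 25600 * (τ + p ^ 2) := by
    rw [hK_def, mul_assoc]
    refine mul_le_mul_of_nonneg_left ?_ (Real.exp_pos _).le
    linarith
  have hpi := Real.pi_gt_three
  refine le_of_mul_le_mul_right ?_ hρx
  have h1 : 2 * (δ * ρ ^ x) ≤ 2 * Real.pi * (δ * ρ ^ x) :=
    mul_le_mul_of_nonneg_right (by linarith) (by positivity)
  have h2 : H0 * K * (√(80 * Real.pi) / √x) ≤ (Real.exp 40 * 25600 * (τ + p ^ 2)) *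
      √(80 * Real.pi) * (2 * Real.exp 1 * (negBinomial r q x * ρ ^ x)) := by
    calc H0 * K * (√(80 * Real.pi) / √x) = K * √(80 * Real.pi) * (H0 / √x) := by ring
      _ ≤ _ := by gcongr
  linarith
end

/-! ### Passage to the limit -/

theorem theorem3 {Ω : ℕ → Type*} [∀ n, MeasurableSpace (Ω n)]
    (μ : ∀ n, Measure (Ω n)) [∀ n, IsProbabilityMeasure (μ n)]
    (p : ℕ → ℝ) (η : ∀ n, Fin (n + 1) → Ω n → ℕ)
    (hη : ∀ n, IsIIDBernoulli (μ n) (η n) (p n))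
    (x : ℕ → ℕ)
    (hp : Tendsto p atTop (𝓝 0))
    (hnp : Tendsto (fun n : ℕ => (n : ℝ) * p n) atTop atTop)
    (hx : (fun n : ℕ => (x n : ℝ) - n * p n ^ 2) =o[atTop]
      fun n : ℕ => min ((n : ℝ) * p n ^ 2) ((n : ℝ) ^ (2 / 3 : ℝ) * p n ^ (2 / 3 : ℝ))) :
    Tendsto (fun n : ℕ => (μ n).real {ω | twoRuns (η n) ω = x n} /
      negBinomial (runsR n (p n)) (runsQbar n (p n)) (x n)) atTop (𝓝 1) := by
  have hpos : ∀ᶠ n : ℕ in atTop, 0 < p n := by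
    filter_upwards [hnp.eventually_gt_atTop 0] with n hn
    exact pos_of_mul_pos_right hn n.cast_nonneg
  have hsmall : ∀ᶠ n : ℕ in atTop, p n ≤ 1 / 1000 := hp.eventually_le_const (by norm_num)
  have hnear : ∀ᶠ n : ℕ in atTop, |(x n : ℝ) - n * p n ^ 2| ≤ n * p n ^ 2 / 2 := by
    filter_upwards [hx.bound (show (0 : ℝ) < 1 / 2 by norm_num), hpos] with n hn hp0
    rw [Real.norm_eq_abs, Real.norm_of_nonneg (by positivity)] at hn
    have := min_le_left ((n : ℝ) * p n ^ 2) ((n : ℝ) ^ (2 / 3 : ℝ) * p n ^ (2 / 3 : ℝ))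
    linarith
  have hτ : Tendsto (fun n : ℕ => |(x n : ℝ) - n * p n ^ 2| ^ 3 * p n ^ 2 / (n * p n ^ 2) ^ 2)
      atTop (𝓝 0) := by
    have h1 : (fun n : ℕ => (x n : ℝ) - n * p n ^ 2) =o[atTop]
        fun n : ℕ => (n : ℝ) ^ (2 / 3 : ℝ) * p n ^ (2 / 3 : ℝ) := by
      refine hx.trans_isBigO (IsBigO.of_bound 1 ?_)
      filter_upwards [hpos] with n hp0
      rw [one_mul, Real.norm_of_nonneg (by positivity), Real.norm_of_nonneg (by positivity)]
      exact min_le_right _ _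
    -- The cube of |x - l|/(np)^(2/3) is exactly τ, since (np)² = l²/p².
    have h2 := (h1.norm_left.tendsto_div_nhds_zero).pow 3
    rw [zero_pow (by norm_num)] at h2
    refine h2.congr' ?_
    filter_upwards [hpos, eventually_ge_atTop 1] with n hp0 hn
    have hn' : (0 : ℝ) < n := by exact_mod_cast hn
    have h3 : ((n : ℝ) ^ (2 / 3 : ℝ) * p n ^ (2 / 3 : ℝ)) ^ 3 = n ^ 2 * p n ^ 2 := by
      rw [mul_pow, ← Real.rpow_natCast, ← Real.rpow_natCast (p n ^ _), ← Real.rpow_mul hn'.le,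
        ← Real.rpow_mul hp0.le]
      norm_num
    rw [div_pow, h3, Real.norm_eq_abs]
    field_simp
  rw [tendsto_iff_norm_sub_tendsto_zero]
  have hlim : Tendsto (fun n : ℕ => Real.exp 40 * 25600 * (√(80 * Real.pi) * Real.exp 1) *
      (|(x n : ℝ) - n * p n ^ 2| ^ 3 * p n ^ 2 / (n * p n ^ 2) ^ 2 + p n ^ 2)) atTop (𝓝 0) := by
    simpa using (hτ.add (hp.pow 2)).const_mul
      (Real.exp 40 * 25600 * (√(80 * Real.pi) * Real.exp 1))
  refine squeeze_zero' (Eventually.of_forall fun _ => norm_nonneg _) ?_ hlim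
  filter_upwards [hpos, hsmall, hnear, hτ.eventually_le_const zero_lt_one,
    eventually_ge_atTop 2] with n hp0 hp1 hxn hτn hn
  obtain ⟨hb, hle⟩ := (hη n).abs_measureReal_twoRuns_sub_negBinomial_le hn hp0 hp1 hxn hτn
  rw [div_sub_one hb.ne', Real.norm_eq_abs, abs_div, abs_of_pos hb, div_le_iff₀ hb]
  exact hle
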